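/- Let $F$ be a finitely generated free group of rank at least $2$, let $\varphi : F \to F$ be any injective homomorphism (surjective or not), and let $$G = \langle F, t \mid t f t^{-1} = \varphi(f) \text{ for all } f \in F \rangle$$ be the associated ascending HNN extension. Then $G$ does not have the finitely generated intersection property; that is, there exist finitely generated subgroups $H, K \le G$ such that $H \cap K$ is not finitely generated. -/

import Mathlib

/-- A group has the finitely generated intersection property if the intersection of any two
finitely generated subgroups is finitely generated. -/
def HasFGIP (G : Type*) [Group G] : Prop :=
  ∀ H K : Subgroup G, H.FG → K.FG → (H ⊓ K).FG

/-- The ascending HNN extension `⟨F, t | t f t⁻¹ = φ f for all f ∈ F⟩` of a monomorphism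
`φ : F → F`: the HNN extension of `F` with associated subgroups `F` and `φ(F)`. -/
abbrev AscendingHNNExtension {F : Type*} [Group F] (φ : F →* F)
    (hφ : Function.Injective φ) : Type _ :=
  HNNExtension F ⊤ φ.range (Subgroup.topEquiv.trans (MonoidHom.ofInjective hφ))

theorem AscendingHNNExtension.t_mul_of_mul_t_inv {F : Type*} [Group F] (φ : F →* F)
    (hφ : Function.Injective φ) (f : F) :
    (HNNExtension.t * HNNExtension.of f * HNNExtension.t⁻¹ : AscendingHNNExtension φ hφ) =
      HNNExtension.of (φ f) :=
  (HNNExtension.equiv_eq_conj (φ := Subgroup.topEquiv.trans (MonoidHom.ofInjective hφ))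
    (⟨f, Subgroup.mem_top f⟩ : (⊤ : Subgroup F))).symm

/-!
Let `N` be the image of `φ`, a finitely generated subgroup of `F`.

If `N` has infinite index, then by Marshall Hall's theorem it is a retract of a subgroup `F₁ ≠ N` of
finite index. Composing the retraction with `φ⁻¹` gives `r : F₁ → F` with `r ∘ φ = id` and an
element `c ≠ 1` of its kernel. The intersection of `⟨c, t⟩` with `F` is generated by the orbit of
`c` under `φ`; the map `r` shifts this orbit down and kills `c`, so on a finitely generated subgroup
some power of it would be trivial, which it is not.

If `N` has finite index, Schreier's formula forces `φ` to be an automorphism, since `N` has the same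
rank as `F`. Suppose that `G` has the property, and let `x` be a commutator of two basis elements.
Then `⟨x, t⟩ ∩ F` is a finitely generated subgroup of `[F, F]` containing all `φ⁻ⁿ x`. For
`s = c tᵏ` the intersection of `F` with the subgroup generated by `s` and `⟨x, t⟩ ∩ F` is again
finitely generated and inside `[F, F]`, and it contains conjugates of `x` by elements
`Cₘ = c · φᵏ c ⋯ φ^((m-1)k) c`. The integer labels of the Magnus embedding of `F / [[F, F], [F, F]]`
show that only finitely many classes of conjugators modulo `[F, F]` are possible, whereas `c` and
`k` can be chosen such that the classes of the `Cₘ` are pairwise distinct.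
-/

open scoped commutatorElement

section FreeGroupBasis

variable {ι F : Type*} [Group F]

theorem closure_range_freeGroupBasis (b : FreeGroupBasis ι F) :
    Subgroup.closure (Set.range b) = ⊤ := by
  calc Subgroup.closure (Set.range b)
      = (Subgroup.closure (Set.range FreeGroup.of)).map b.repr.symm.toMonoidHom := by
        rw [MonoidHom.map_closure, ← Set.range_comp]; rfl
    _ = ⊤ := by
        rw [FreeGroup.closure_range_of, Subgroup.map_top_of_surjective _ b.repr.symm.surjective]

theorem lift_mem_of_forall_mem {G : Type*} [Group G] (b : FreeGroupBasis ι F) {f : ι → G}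
    {K : Subgroup G} (hf : ∀ i, f i ∈ K) (g : F) : b.lift f g ∈ K := by
  have h : Subgroup.closure (Set.range b) ≤ K.comap (b.lift f) := by
    rw [Subgroup.closure_le]
    rintro _ ⟨i, rfl⟩
    simpa using hf i
  rw [closure_range_freeGroupBasis] at h
  exact h (Subgroup.mem_top g)

theorem finite_of_freeGroupBasis [Group.FG F] (b : FreeGroupBasis ι F) : Finite ι := by
  obtain ⟨S, hS, hSfin⟩ := Group.fg_iff.1 ‹Group.FG F›
  have : Finite S := hSfin
  let L := Multiplicative (ZMod 2)
  have : Finite (F →* L) := Finite.of_injective (fun (f : F →* L) (x : S) => f x) fun f g h =>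
    MonoidHom.eq_of_eqOn_dense hS fun x hx => congrFun h ⟨x, hx⟩
  have : Finite (ι → L) := Finite.of_equiv _ b.lift.symm
  by_contra h
  have := not_finite_iff_infinite.1 h
  exact not_finite (ι → L)

end FreeGroupBasis

/-- The unrestricted permutational wreath product of `L` by the action of `Q` on `Y`. In
`⟨v, q⟩ * ⟨w, r⟩` the function `w` is translated by `q`, so `v y` is the label of the arrow of
`q` which *ends* at `y`. -/
abbrev PermWreath (L Q Y : Type*) [Group L] [Group Q] [MulAction Q Y] : Type _ :=
  (Y → L) ⋊[mulAutArrow] Q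

namespace PermWreath

variable {L Q Y : Type*} [Group L] [Group Q] [MulAction Q Y]

theorem mul_left_apply (v w : PermWreath L Q Y) (y : Y) :
    (v * w).left y = v.left y * w.left (v.right⁻¹ • y) :=
  rfl

theorem inv_left_apply (v : PermWreath L Q Y) (y : Y) :
    (v⁻¹).left y = (v.left (v.right • y))⁻¹ := by
  rw [SemidirectProduct.inv_left]
  change v.left⁻¹ (v.right⁻¹⁻¹ • y) = _
  rw [inv_inv, Pi.inv_apply]

/-- Reading off the label at a point `y` that every `f h` fixes. -/
def leftEval {H : Type*} [Group H] (f : H →* PermWreath L Q Y) (y : Y)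
    (hf : ∀ h, (f h).right • y = y) : H →* L where
  toFun h := (f h).left y
  map_one' := by simp
  map_mul' g h := by rw [map_mul, mul_left_apply, inv_smul_eq_iff.2 (hf g).symm]

/-- In the graph of `w` the arrow starting at `x` has label `g` and ends at `y`. -/
def Carries (w : PermWreath L Q Y) (x : Y) (g : L) (y : Y) : Prop :=
  w.right • x = y ∧ w.left y = g

theorem Carries.one (y : Y) : (1 : PermWreath L Q Y).Carries y 1 y := by
  simp [Carries]

theorem Carries.mul {v w : PermWreath L Q Y} {x y z : Y} {g h : L} (hv : v.Carries y g z)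
    (hw : w.Carries x h y) : (v * w).Carries x (g * h) z := by
  obtain ⟨rfl, rfl⟩ := hv
  obtain ⟨rfl, rfl⟩ := hw
  exact ⟨mul_smul _ _ _, by rw [mul_left_apply, inv_smul_smul]⟩

theorem Carries.inv {w : PermWreath L Q Y} {x y : Y} {g : L} (hw : w.Carries x g y) :
    (w⁻¹).Carries y g⁻¹ x := by
  obtain ⟨rfl, rfl⟩ := hw
  exact ⟨inv_smul_smul _ _, inv_left_apply _ _⟩

theorem carries_of_mem_closure {f : L →* PermWreath L Q Y} {y : Y} {S : Set L}
    (hS : ∀ s ∈ S, (f s).Carries y s y) {g : L} (hg : g ∈ Subgroup.closure S) :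
    (f g).Carries y g y := by
  induction hg using Subgroup.closure_induction with
  | mem s hs => exact hS s hs
  | one => exact map_one f ▸ Carries.one y
  | mul g h _ _ ihg ihh => exact map_mul f g h ▸ ihg.mul ihh
  | inv g _ ih => exact map_inv f g ▸ ih.inv

/-- The restricted permutational wreath product, as a subgroup of the unrestricted one. -/
def finiteSupport (L Q Y : Type*) [Group L] [Group Q] [MulAction Q Y] :
    Subgroup (PermWreath L Q Y) where
  carrier := {w | (Function.mulSupport w.left).Finite}
  one_mem' := by simp
  mul_mem' {v w} hv hw := by
    refine (hv.union (hw.image (v.right • ·))).subset fun y hy => ?_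
    by_contra h
    rw [Set.mem_union, not_or, Function.notMem_mulSupport, Set.mem_image] at h
    have hw1 : w.left (v.right⁻¹ • y) = 1 := by
      by_contra hw1
      exact h.2 ⟨_, hw1, smul_inv_smul _ _⟩
    exact hy (by rw [mul_left_apply, h.1, hw1, one_mul])
  inv_mem' {w} hw := by
    refine (hw.image (w.right⁻¹ • ·)).subset fun y hy => ?_
    rw [Function.mem_mulSupport, inv_left_apply, inv_ne_one] at hy
    exact ⟨_, hy, inv_smul_smul _ _⟩

/-- The elements which fix `Y` pointwise and are supported in `V`. -/
def supportedIn (L Q : Type*) {Y : Type*} [Group L] [Group Q] [MulAction Q Y] (V : Set Y) :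
    Subgroup (PermWreath L Q Y) where
  carrier := {w | (∀ y : Y, w.right • y = y) ∧ ∀ y ∉ V, w.left y = 1}
  one_mem' := by simp
  mul_mem' {v w} hv hw := by
    refine ⟨fun y => ?_, fun y hy => ?_⟩
    · rw [SemidirectProduct.mul_right, mul_smul, hw.1, hv.1]
    · rw [mul_left_apply, inv_smul_eq_iff.2 (hv.1 y).symm, hv.2 y hy, hw.2 y hy, one_mul]
  inv_mem' {w} hw := by
    refine ⟨fun y => inv_smul_eq_iff.2 (hw.1 y).symm, fun y hy => ?_⟩
    rw [inv_left_apply, hw.1, hw.2 y hy, inv_one]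

theorem conj_left_apply {w : PermWreath L Q Y} (hw : ∀ y : Y, w.right • y = y)
    (v : PermWreath L Q Y) (y : Y) :
    (v * w * v⁻¹).left (v.right • y) =
      v.left (v.right • y) * w.left y * (v.left (v.right • y))⁻¹ := by
  simp only [mul_left_apply, inv_left_apply, SemidirectProduct.mul_right, mul_inv_rev, mul_smul,
    inv_smul_smul, inv_smul_eq_iff.2 (hw y).symm]

theorem finite_setOf_conj_mem {F : Type*} [Group F] {f : F →* PermWreath L Q Y}
    (hf : ∀ g, f g ∈ finiteSupport L Q Y) {P : Subgroup F} (hP : P.FG)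
    (hPY : ∀ p ∈ P, ∀ y : Y, (f p).right • y = y) {x : F} (hx : ∀ y : Y, (f x).right • y = y)
    {y : Y} (hxy : (f x).left y ≠ 1) :
    {z | ∃ g : F, (f g).right • y = z ∧ g * x * g⁻¹ ∈ P}.Finite := by
  obtain ⟨S, rfl, hSfin⟩ := (Subgroup.fg_iff _).1 hP
  let V : Set Y := ⋃ s ∈ S, Function.mulSupport (f s).left
  have hV : V.Finite := hSfin.biUnion fun s _ => hf s
  have hPV : Subgroup.closure S ≤ (supportedIn L Q V).comap f :=
    (Subgroup.closure_le _).2 fun s hs => ⟨hPY s (Subgroup.subset_closure hs), fun y hy => by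
      by_contra h
      exact hy (Set.mem_biUnion hs h)⟩
  refine hV.subset ?_
  rintro _ ⟨g, rfl, hg⟩
  by_contra hgV
  have h := (hPV hg).2 _ hgV
  rw [map_mul, map_mul, map_inv, conj_left_apply hx, conj_eq_one_iff] at h
  exact hxy h

end PermWreath

section Schreier

variable {ι κ F L Y : Type*} [Group F] [Group L] [MulAction F Y]

/-- The homomorphism from a free group to a wreath product over itself which gives the arrow of
`b i` ending at `y` the label `l i y`. -/
def labelHom (b : FreeGroupBasis ι F) (l : ι → Y → L) : F →* PermWreath L F Y :=
  b.lift fun i => ⟨l i, b i⟩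

theorem labelHom_right (b : FreeGroupBasis ι F) (l : ι → Y → L) (g : F) :
    (labelHom b l g).right = g := by
  have h : SemidirectProduct.rightHom.comp (labelHom b l) = MonoidHom.id F :=
    b.ext_hom _ _ fun i => by simp [labelHom]
  exact DFunLike.congr_fun h g

theorem labelHom_mul_left (b : FreeGroupBasis ι F) (l : ι → Y → L) (g h : F) (y : Y) :
    (labelHom b l (g * h)).left (g • y) =
      (labelHom b l g).left (g • y) * (labelHom b l h).left y := by
  rw [map_mul, PermWreath.mul_left_apply, labelHom_right, inv_smul_smul]

theorem labelHom_mem_finiteSupport (b : FreeGroupBasis ι F) {l : ι → Y → L}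
    (hl : ∀ i, (Function.mulSupport (l i)).Finite) (g : F) :
    labelHom b l g ∈ PermWreath.finiteSupport L F Y :=
  lift_mem_of_forall_mem b hl g

/-- The labels of the loops at `y` in the Schreier graph of the action. -/
def loopLabelHom (b : FreeGroupBasis ι F) (y : Y) (l : ι → Y → L) :
    MulAction.stabilizer F y →* L :=
  PermWreath.leftEval ((labelHom b l).comp (Subgroup.subtype _)) y fun m =>
    (labelHom_right b l m).symm ▸ m.2

theorem eq_of_loopLabelHom_eq (b : FreeGroupBasis ι F) {y₀ : Y} {τ : Y → F}
    (hτ : ∀ y, τ y • y₀ = y) {l l' : ι → Y → L} (hloop : loopLabelHom b y₀ l = loopLabelHom b y₀ l')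
    (hpath : ∀ y ≠ y₀, (labelHom b l (τ y)).left y = (labelHom b l' (τ y)).left y) : l = l' := by
  have eq_loop (m : F) (hm : m • y₀ = y₀) : (labelHom b l m).left y₀ = (labelHom b l' m).left y₀ :=
    DFunLike.congr_fun hloop ⟨m, hm⟩
  have eq_path (y : Y) : (labelHom b l (τ y)).left y = (labelHom b l' (τ y)).left y := by
    obtain rfl | hy := eq_or_ne y y₀
    · exact eq_loop _ (hτ y)
    · exact hpath y hy
  have eq_all (g : F) : (labelHom b l g).left (g • y₀) = (labelHom b l' g).left (g • y₀) := by
    have hg : τ (g • y₀) * ((τ (g • y₀))⁻¹ * g) = g := mul_inv_cancel_left _ _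
    have h (l : ι → Y → L) := labelHom_mul_left b l (τ (g • y₀)) ((τ (g • y₀))⁻¹ * g) y₀
    simp only [hg, hτ] at h
    rw [h, h, eq_path, eq_loop _ (by rw [mul_smul, inv_smul_eq_iff, hτ])]
  funext i y
  have hi (l : ι → Y → L) : (labelHom b l (b i)).left y = l i y := by simp [labelHom]
  have h (l : ι → Y → L) := labelHom_mul_left b l (b i) (τ ((b i)⁻¹ • y)) ((b i)⁻¹ • y)
  have hy := eq_all (b i * τ ((b i)⁻¹ • y))
  simp only [mul_smul, hτ, smul_inv_smul] at h hy
  rw [h, h, eq_path, hi, hi] at hy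
  exact mul_right_cancel hy

theorem card_mul_index_lt [Finite ι] [Finite κ] (b : FreeGroupBasis ι F) {M : Subgroup F}
    [M.FiniteIndex] (c : FreeGroupBasis κ M) :
    Nat.card ι * M.index < Nat.card κ + M.index := by
  classical
  let Y := F ⧸ M
  let y₀ : Y := (1 : F)
  let L := Multiplicative (ZMod 2)
  have hM : MulAction.stabilizer F y₀ = M := MulAction.stabilizer_quotient M
  have hτ (y : Y) : y.out • y₀ = y := by
    rw [MulAction.Quotient.smul_coe, smul_eq_mul, mul_one, QuotientGroup.out_eq']
  let c' : FreeGroupBasis κ (MulAction.stabilizer F y₀) := c.map (MulEquiv.subgroupCongr hM.symm)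
  -- A labelling is determined by its labels on loops and on a transversal: count labellings.
  let Φ (l : ι → Y → L) : (κ → L) × ({y // y ≠ y₀} → L) :=
    (c'.lift.symm (loopLabelHom b y₀ l), fun y => (labelHom b l y.1.out).left y)
  have hΦ : Function.Injective Φ := fun l l' h =>
    eq_of_loopLabelHom_eq b hτ (c'.lift.symm.injective (congrArg Prod.fst h)) fun y hy =>
      congrFun (congrArg Prod.snd h) ⟨y, hy⟩
  have hcard := Nat.card_le_card_of_injective Φ hΦ
  have hY : Nat.card Y = M.index := rfl
  have hL : Nat.card L = 2 := Nat.card_zmod 2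
  have hY' : Nat.card {y // y ≠ y₀} + 1 = M.index := by
    rw [← hY, ← Nat.card_congr (Equiv.sumCompl (· = y₀)), Nat.card_sum, add_comm,
      Nat.card_unique (α := {y // y = y₀})]
  rw [Nat.card_prod, Nat.card_fun, Nat.card_fun, Nat.card_fun, Nat.card_fun, hY, hL, ← pow_mul,
    ← pow_add, Nat.pow_le_pow_iff_right one_lt_two, mul_comm] at hcard
  omega

theorem eq_top_of_finiteIndex [Finite ι] (b : FreeGroupBasis ι F) {M : Subgroup F}
    [M.FiniteIndex] (c : FreeGroupBasis ι M) (hι : 2 ≤ Nat.card ι) : M = ⊤ := by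
  have h := card_mul_index_lt b c
  have h0 : M.index ≠ 0 := Subgroup.FiniteIndex.index_ne_zero
  rw [← Subgroup.index_eq_one]
  by_contra h1
  have h2 : 2 ≤ M.index := by omega
  nlinarith

end Schreier

section MarshallHall

open PermWreath Filter

variable {ι F X : Type*} [Group F] [MulAction F X]

/-- The elements of the wreath product whose arrow from `x` to `y` is labelled by an element of `F`
which moves `x` to `y`, for all `x` and `y` in `Y`. -/
def compatible (F : Type*) [Group F] [MulAction F X] (Y : Finset X) :
    Subgroup (PermWreath F (Equiv.Perm Y) Y) where
  carrier := {w | ∀ y : Y, w.left y • ((w.right⁻¹ • y : Y) : X) = y}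
  one_mem' y := by simp
  mul_mem' {v w} hv hw y := by
    rw [mul_left_apply, SemidirectProduct.mul_right, mul_inv_rev, mul_smul, mul_smul, hw, hv]
  inv_mem' {w} hw y := by
    have := hw (w.right • y)
    rw [inv_smul_smul] at this
    rw [inv_left_apply, SemidirectProduct.inv_right, inv_inv, inv_smul_eq_iff, this]

/-- Every arrow of `g` with both ends in `Y` is an arrow of `w` with label `g`. -/
def Represents {Y : Finset X} (w : PermWreath F (Equiv.Perm Y) Y) (g : F) : Prop :=
  ∀ x y : Y, g • (x : X) = y → w.Carries x g y

theorem exists_mem_compatible_represents [MulAction.IsPretransitive F X] (Y : Finset X) (g : F) :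
    ∃ w ∈ compatible F Y, Represents w g := by
  classical
  obtain ⟨σ, hσ⟩ := Equiv.Perm.exists_extending_pair
    (fun p : {x : Y // g • (x : X) ∈ Y} => p.1) (fun p => ⟨g • (p.1 : X), p.2⟩)
    Subtype.val_injective fun p q h =>
      Subtype.ext (Subtype.ext (MulAction.injective g (congrArg Subtype.val h)))
  choose a ha using fun y : Y => MulAction.exists_smul_eq F ((σ⁻¹ y : Y) : X) y
  let w : PermWreath F (Equiv.Perm Y) Y :=
    ⟨fun y => if g • ((σ⁻¹ y : Y) : X) = y then g else a y, σ⟩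
  refine ⟨w, fun y => ?_, fun x y hxy => ?_⟩
  · simp only [w, Equiv.Perm.smul_def]
    split_ifs with h
    exacts [h, ha y]
  · have hσx : σ x = y := (hσ ⟨x, hxy ▸ y.2⟩).trans (Subtype.ext hxy)
    refine ⟨hσx, if_pos ?_⟩
    rw [← hσx, ← Equiv.Perm.mul_apply, inv_mul_cancel, Equiv.Perm.one_apply, hσx, hxy]

theorem eventually_carries (b : FreeGroupBasis ι F) (g : F) (x : X) :
    ∀ᶠ Y : Finset X in atTop, ∀ ρ : F →* PermWreath F (Equiv.Perm Y) Y,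
      (∀ i, Represents (ρ (b i)) (b i)) →
      ∃ x' y' : Y, (x' : X) = x ∧ (y' : X) = g • x ∧ (ρ g).Carries x' g y' := by
  classical
  have hg : g ∈ Subgroup.closure (Set.range b) :=
    closure_range_freeGroupBasis b ▸ Subgroup.mem_top g
  induction hg using Subgroup.closure_induction generalizing x with
  | mem g hg =>
    obtain ⟨i, rfl⟩ := hg
    filter_upwards [eventually_ge_atTop {x, b i • x}] with Y hY ρ hρ
    have hx : x ∈ Y := hY (by simp)
    have hy : b i • x ∈ Y := hY (by simp)
    exact ⟨⟨x, hx⟩, ⟨b i • x, hy⟩, rfl, rfl, hρ i _ _ rfl⟩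
  | one =>
    filter_upwards [eventually_ge_atTop {x}] with Y hY ρ _
    have hx : x ∈ Y := hY (by simp)
    exact ⟨⟨x, hx⟩, ⟨x, hx⟩, rfl, (one_smul F x).symm, map_one ρ ▸ Carries.one _⟩
  | mul g h _ _ ihg ihh =>
    filter_upwards [ihh x, ihg (h • x)] with Y hh hg ρ hρ
    obtain ⟨x', y', hx, hy, hh⟩ := hh ρ hρ
    obtain ⟨y'', z', hy', hz, hg⟩ := hg ρ hρ
    obtain rfl : y' = y'' := Subtype.ext (hy.trans hy'.symm)
    exact ⟨x', z', hx, hz.trans (mul_smul g h x).symm, map_mul ρ g h ▸ hg.mul hh⟩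
  | inv g _ ih =>
    filter_upwards [ih (g⁻¹ • x)] with Y h ρ hρ
    obtain ⟨x', y', hx, hy, h⟩ := h ρ hρ
    exact ⟨y', x', hy.trans (smul_inv_smul g x), hx, map_inv ρ g ▸ h.inv⟩

theorem exists_finiteIndex_retraction (b : FreeGroupBasis ι F) {N : Subgroup F} (hN : N.FG) :
    ∃ F₁ : Subgroup F, F₁.FiniteIndex ∧ ∃ (hle : N ≤ F₁) (r : F₁ →* N),
      ∀ n : N, r (Subgroup.inclusion hle n) = n := by
  obtain ⟨S, hS, hSfin⟩ := (Subgroup.fg_iff _).1 hN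
  let x₀ : F ⧸ N := (1 : F)
  have mem_N (n : F) : n ∈ N ↔ n • x₀ = x₀ := by
    rw [← MulAction.mem_stabilizer_iff, MulAction.stabilizer_quotient]
  obtain ⟨Y, hx₀, hY⟩ := ((eventually_ge_atTop {x₀}).and
    ((hSfin.eventually_all).2 fun n _ => eventually_carries b n x₀)).exists
  choose w hwc hwr using fun i => exists_mem_compatible_represents Y (b i)
  let ρ := b.lift w
  have hρ (g : F) : ρ g ∈ compatible F Y := lift_mem_of_forall_mem b hwc g
  let y₀ : Y := ⟨x₀, hx₀ (Finset.mem_singleton_self _)⟩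
  let F₁ : Subgroup F :=
    (MulAction.stabilizer (Equiv.Perm Y) y₀).comap (SemidirectProduct.rightHom.comp ρ)
  let r₀ : F₁ →* F := leftEval (ρ.comp F₁.subtype) y₀ fun m => m.2
  have hr₀ (m : F₁) : r₀ m ∈ N := by
    have h := hρ m y₀
    have hm : (ρ m).right⁻¹ • y₀ = y₀ := inv_smul_eq_iff.2 (Eq.symm m.2)
    rwa [hm, ← mem_N] at h
  have hcarry (n : F) (hn : n ∈ N) : (ρ n).Carries y₀ n y₀ := by
    refine carries_of_mem_closure (fun s hs => ?_) (hS ▸ hn)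
    obtain ⟨x', y', hx, hy, h⟩ := hY s hs ρ fun i => by simpa [ρ] using hwr i
    rw [(mem_N s).1 (hS ▸ Subgroup.subset_closure hs)] at hy
    obtain rfl : x' = y₀ := Subtype.ext hx
    obtain rfl : y' = y₀ := Subtype.ext hy
    exact h
  refine ⟨F₁, ?_, fun n hn => (hcarry n hn).1, r₀.codRestrict N hr₀, fun n =>
    Subtype.ext (hcarry n n.2).2⟩
  exact Subgroup.finiteIndex_of_le (Subgroup.ker_le_comap (SemidirectProduct.rightHom.comp ρ) _)

end MarshallHall

section Commutator

variable {ι F : Type*} [Group F]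

theorem not_isOfFinOrder_abelianization_of (b : FreeGroupBasis ι F) (i : ι) :
    ¬ IsOfFinOrder (Abelianization.of (b i)) := by
  intro h
  have h1 := (Abelianization.lift (b.lift fun _ => Multiplicative.ofAdd (1 : ℤ))).isOfFinOrder h
  exact not_isOfFinOrder_of_isMulTorsionFree (a := Multiplicative.ofAdd (1 : ℤ)) (by decide)
    (by simpa using h1)

open scoped Classical in
theorem labelHom_mulSingle_commutator {L : Type*} [Group L] (b : FreeGroupBasis ι F) {i j : ι}
    (hij : i ≠ j) (a : L) :
    (labelHom b (Pi.mulSingle i (Pi.mulSingle (1 : F ⧸ commutator F) a)) ⁅b i, b j⁆).left 1 =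
      a := by
  -- The loop crosses the labelled arrow only once.
  have hj : b i • (b j)⁻¹ • (b i)⁻¹ • (1 : F ⧸ commutator F) ≠ 1 := by
    rw [← mul_smul, ← mul_smul, ← QuotientGroup.mk_one, Ne, ← MulAction.mem_stabilizer_iff,
      MulAction.stabilizer_quotient, ← Abelianization.ker_of, MonoidHom.mem_ker]
    intro h
    have h1 : Abelianization.of (b j) = 1 := by simpa [mul_comm] using h
    exact not_isOfFinOrder_abelianization_of b j (h1 ▸ IsOfFinOrder.one)
  simp [commutatorElement_def, labelHom, PermWreath.mul_left_apply,
    PermWreath.inv_left_apply, hij.symm, mul_smul, Pi.mulSingle_eq_of_ne hj]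

theorem finite_abelianization_conj_commutator_mem (b : FreeGroupBasis ι F) {i j : ι} (hij : i ≠ j)
    {P : Subgroup F} (hP : P.FG) (hPF : P ≤ commutator F) :
    {d | ∃ g : F, Abelianization.of g = d ∧ g * ⁅b i, b j⁆ * g⁻¹ ∈ P}.Finite := by
  classical
  let a := Multiplicative.ofAdd (1 : ℤ)
  let y₀ : F ⧸ commutator F := 1
  let l : ι → F ⧸ commutator F → Multiplicative ℤ := Pi.mulSingle i (Pi.mulSingle y₀ a)
  have hl (k : ι) : (Function.mulSupport (l k)).Finite := by
    obtain rfl | hk := eq_or_ne k i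
    · simpa [l] using (Set.finite_singleton y₀).subset Pi.mulSupport_mulSingle_subset
    · simp [l, hk]
  have smul_eq (g : F) (hg : g ∈ commutator F) (y : F ⧸ commutator F) :
      (labelHom b l g).right • y = y := by
    obtain ⟨f, rfl⟩ := QuotientGroup.mk_surjective y
    rw [labelHom_right, MulAction.Quotient.smul_mk, eq_comm, QuotientGroup.eq, smul_eq_mul,
      ← mul_assoc]
    exact Subgroup.Normal.conj_mem' inferInstance g hg f
  have h := PermWreath.finite_setOf_conj_mem (y := y₀) (labelHom_mem_finiteSupport b hl) hP
    (fun p hp => smul_eq p (hPF hp))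
    (smul_eq ⁅b i, b j⁆
      (Subgroup.commutator_mem_commutator (Subgroup.mem_top _) (Subgroup.mem_top _)))
    (by rw [labelHom_mulSingle_commutator b hij]; decide)
  have smul_y₀ (g : F) : g • y₀ = Abelianization.of g := congrArg QuotientGroup.mk (mul_one g)
  simpa only [labelHom_right, smul_y₀] using! h

end Commutator

section TwistedOrbit

variable {D : Type*} [Group D]

theorem exists_iterate_eq_id_of_periodic [Group.FG D] (α : Monoid.End D)
    (hα : ∀ x, x ∈ Function.periodicPts α) : ∃ k, 0 < k ∧ α^[k] = id := by
  obtain ⟨S, hS, hSfin⟩ := Group.fg_iff.1 ‹Group.FG D›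
  have eventually_fixed (x : D) : ∀ᶠ k : ℕ in Filter.atTop, α^[k.factorial] x = x := by
    obtain ⟨p, hp, hpx⟩ := hα x
    filter_upwards [Filter.eventually_ge_atTop p] with k hk
    exact hpx.trans_dvd (Nat.dvd_factorial hp hk)
  obtain ⟨k, hk⟩ := (hSfin.eventually_all.2 fun x _ => eventually_fixed x).exists
  refine ⟨k.factorial, k.factorial_pos, ?_⟩
  rw [← Monoid.End.coe_pow] at hk ⊢
  exact congrArg DFunLike.coe (MonoidHom.eq_of_eqOn_dense (g := .id D) hS hk)

theorem iterate_mul_apply (d : D) (α : Monoid.End D) (m : ℕ) (x : D) :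
    (fun y => d * α y)^[m] x = (fun y => d * α y)^[m] 1 * α^[m] x := by
  induction m with
  | zero => simp
  | succ m ih =>
    simp only [Function.iterate_succ_apply']
    rw [ih, map_mul, mul_assoc]

theorem iterate_mul_one_injective {d : D} {α : Monoid.End D} (hα : Function.Injective α)
    (hd : d ∉ Function.periodicPts α) :
    Function.Injective fun m => (fun x => d * α x)^[m] 1 := by
  let T (x : D) : D := d * α x
  have hT : Function.Injective T := (mul_right_injective d).comp hα
  have hT1 : T 1 = d := by simp [T]
  have ne_of_lt {m n : ℕ} (hmn : n < m) : T^[m] 1 ≠ T^[n] 1 := fun h => by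
    have hp : T^[m - n] 1 = 1 := Function.iterate_cancel hT h
    have hpd : T^[m - n] d = d := by
      rw [← hT1, ← Function.iterate_succ_apply, Function.iterate_succ_apply', hp]
    refine hd (Function.mk_mem_periodicPts (Nat.sub_pos_of_lt hmn) ?_)
    calc α^[m - n] d = T^[m - n] 1 * α^[m - n] d := by rw [hp, one_mul]
      _ = d := (iterate_mul_apply d α (m - n) d).symm.trans hpd
  intro m n h
  by_contra hmn
  exact (lt_or_gt_of_ne hmn).elim (fun hlt => ne_of_lt hlt h.symm) fun hlt => ne_of_lt hlt h

theorem exists_iterate_mul_one_injective [Group.FG D] {x : D} (hx : ¬ IsOfFinOrder x)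
    {α : Monoid.End D} (hα : Function.Injective α) :
    ∃ k, 0 < k ∧ ∃ d, Function.Injective fun m => (fun y => d * α^[k] y)^[m] 1 := by
  by_cases hper : ∀ y, y ∈ Function.periodicPts α
  · obtain ⟨k, hk, hαk⟩ := exists_iterate_eq_id_of_periodic α hper
    refine ⟨k, hk, x, ?_⟩
    simpa [hαk, mul_left_iterate] using! injective_pow_iff_not_isOfFinOrder.2 hx
  · push Not at hper
    obtain ⟨d, hd⟩ := hper
    exact ⟨1, one_pos, d, iterate_mul_one_injective hα hd⟩

end TwistedOrbit

theorem exists_iterate_eq_one_of_fg {N : Type*} [Group N] [Group.FG N] (s : Monoid.End N)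
    {T : Set N} (hT : Subgroup.closure T = ⊤) (hs : ∀ n ∈ T, ∃ k, s^[k] n = 1) :
    ∃ k, ∀ n, s^[k] n = 1 := by
  obtain ⟨S, hS, hSfin⟩ := Group.fg_iff.1 ‹Group.FG N›
  have eventually_eq_one (n : N) : ∀ᶠ k in Filter.atTop, s^[k] n = 1 := by
    have hn : n ∈ Subgroup.closure T := hT ▸ Subgroup.mem_top n
    induction hn using Subgroup.closure_induction with
    | mem n hn =>
      obtain ⟨k, hk⟩ := hs n hn
      filter_upwards [Filter.eventually_ge_atTop k] with l hl
      rw [← Nat.sub_add_cancel hl, Function.iterate_add_apply, hk, iterate_map_one]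
    | one => exact .of_forall (iterate_map_one s)
    | mul m n _ _ hm hn =>
      filter_upwards [hm, hn] with k hm hn
      rw [iterate_map_mul, hm, hn, one_mul]
    | inv n _ hn =>
      filter_upwards [hn] with k hn
      rw [iterate_map_inv, hn, inv_one]
  obtain ⟨k, hk⟩ := (hSfin.eventually_all.2 fun n _ => eventually_eq_one n).exists
  refine ⟨k, fun n => ?_⟩
  rw [← Monoid.End.coe_pow] at hk ⊢
  exact DFunLike.congr_fun (MonoidHom.eq_of_eqOn_dense (g := 1) hS hk) n

section OrbitSubgroup

variable {F : Type*} [Group F] {φ : F →* F}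

/-- The smallest `φ`-invariant subgroup containing `c`. -/
def orbitSubgroup (φ : F →* F) (c : F) : Subgroup F :=
  Subgroup.closure (Set.range fun k => φ^[k] c)

theorem iterate_mem_orbitSubgroup (φ : F →* F) (c : F) (k : ℕ) : φ^[k] c ∈ orbitSubgroup φ c :=
  Subgroup.subset_closure ⟨k, rfl⟩

theorem map_mem_orbitSubgroup {c f : F} (hf : f ∈ orbitSubgroup φ c) :
    φ f ∈ orbitSubgroup φ c := by
  have h : orbitSubgroup φ c ≤ (orbitSubgroup φ c).comap φ := by
    refine (Subgroup.closure_le _).2 ?_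
    rintro _ ⟨k, rfl⟩
    simpa only [Function.iterate_succ_apply'] using! iterate_mem_orbitSubgroup φ c (k + 1)
  exact h hf

theorem orbitSubgroup_le {F₁ : Subgroup F} (hφF₁ : φ.range ≤ F₁) {c : F} (hc : c ∈ F₁) :
    orbitSubgroup φ c ≤ F₁ := by
  refine (Subgroup.closure_le _).2 ?_
  rintro _ ⟨_ | k, rfl⟩
  · exact hc
  · exact hφF₁ ⟨φ^[k] c, (Function.iterate_succ_apply' φ k c).symm⟩

variable {F₁ : Subgroup F} (hφF₁ : φ.range ≤ F₁) (r : F₁ →* F)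
  (hr : ∀ f, r ⟨φ f, hφF₁ ⟨f, rfl⟩⟩ = f) {c : F₁} (hrc : r c = 1)

include hr hrc

theorem apply_mem_orbitSubgroup (x : F₁) (hx : (x : F) ∈ orbitSubgroup φ (c : F)) :
    r x ∈ orbitSubgroup φ (c : F) := by
  have h : orbitSubgroup φ (c : F) ≤ ((orbitSubgroup φ (c : F)).comap r).map F₁.subtype := by
    refine (Subgroup.closure_le _).2 ?_
    rintro _ ⟨_ | k, rfl⟩
    · exact ⟨c, by simp [hrc], rfl⟩
    · refine ⟨⟨φ (φ^[k] c), hφF₁ ⟨_, rfl⟩⟩, ?_, (Function.iterate_succ_apply' φ k _).symm⟩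
      simpa [hr] using iterate_mem_orbitSubgroup φ (c : F) k
  obtain ⟨y, hy, hyx⟩ := h hx
  rwa [Subtype.ext hyx] at hy

theorem orbitSubgroup_comap_eq : (orbitSubgroup φ (c : F)).comap φ = orbitSubgroup φ c :=
  le_antisymm (fun f hf => hr f ▸ apply_mem_orbitSubgroup hφF₁ r hr hrc _ hf) fun _ =>
    map_mem_orbitSubgroup

theorem orbitSubgroup_not_fg (hc : c ≠ 1) : ¬ (orbitSubgroup φ (c : F)).FG := by
  intro hfg
  let N := orbitSubgroup φ (c : F)
  have : Group.FG N := (Group.fg_iff_subgroup_fg _).2 hfg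
  have hN : N ≤ F₁ := orbitSubgroup_le hφF₁ c.2
  let s : Monoid.End N := (r.comp (Subgroup.inclusion hN)).codRestrict N fun n =>
    apply_mem_orbitSubgroup hφF₁ r hr hrc _ n.2
  let u (k : ℕ) : N := ⟨φ^[k] c, iterate_mem_orbitSubgroup φ (c : F) k⟩
  have shift_succ (k : ℕ) : s (u (k + 1)) = u k := by
    have h : (⟨φ^[k + 1] c, hN (u (k + 1)).2⟩ : F₁) = ⟨φ (φ^[k] c), hφF₁ ⟨_, rfl⟩⟩ :=
      Subtype.ext (Function.iterate_succ_apply' φ k c)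
    exact Subtype.ext ((congrArg r h).trans (hr _))
  have iterate_shift (k : ℕ) : s^[k] (u k) = u 0 := by
    induction k with
    | zero => rfl
    | succ k ih => rw [Function.iterate_succ_apply, shift_succ, ih]
  have shift_zero : s (u 0) = 1 := Subtype.ext hrc
  obtain ⟨k, hk⟩ := exists_iterate_eq_one_of_fg s Subgroup.closure_closure_coe_preimage
    fun n hn => by
      obtain ⟨k, hk⟩ := hn
      obtain rfl : u k = n := Subtype.ext hk
      exact ⟨k + 1, by rw [Function.iterate_succ_apply', iterate_shift, shift_zero]⟩
  have h0 : u 0 = 1 := (iterate_shift k).symm.trans (hk _)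
  exact hc (Subtype.ext congr(($h0 : F)))

end OrbitSubgroup

theorem map_fg {G H : Type*} [Group G] [Group H] {N : Subgroup G} (hN : N.FG) (f : G →* H) :
    (N.map f).FG :=
  (Subgroup.fg_iff_submonoid_fg _).2 (((Subgroup.fg_iff_submonoid_fg N).1 hN).map f)

namespace AscendingHNNExtension

open HNNExtension

variable {F : Type*} [Group F] {φ : F →* F} {hφ : Function.Injective φ}

theorem of_injective : Function.Injective (of : F →* AscendingHNNExtension φ hφ) :=
  HNNExtension.of_injective _

/-- The homomorphism to `ℤ` which kills `F` and sends the stable letter to `1`. -/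
noncomputable def height (φ : F →* F) (hφ : Function.Injective φ) :
    AscendingHNNExtension φ hφ →* Multiplicative ℤ :=
  lift 1 (Multiplicative.ofAdd 1) (by simp)

theorem height_of (f : F) : height φ hφ (of f) = 1 :=
  lift_of ..

theorem height_t : height φ hφ t = Multiplicative.ofAdd 1 :=
  lift_t ..

theorem t_mul_of (f : F) : (t * of f : AscendingHNNExtension φ hφ) = of (φ f) * t := by
  rw [← t_mul_of_mul_t_inv φ hφ f, inv_mul_cancel_right]

theorem t_pow_mul_of (k : ℕ) (f : F) :
    (t ^ k * of f : AscendingHNNExtension φ hφ) = of (φ^[k] f) * t ^ k := by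
  induction k with
  | zero => simp
  | succ k ih =>
    rw [pow_succ', mul_assoc, ih, ← mul_assoc, t_mul_of, Function.iterate_succ_apply', mul_assoc]

theorem comap_of_fg [Group.FG F] (h : HasFGIP (AscendingHNNExtension φ hφ))
    {H : Subgroup (AscendingHNNExtension φ hφ)} (hH : H.FG) : (H.comap of).FG := by
  have h1 : ((H.comap of).map (of : F →* AscendingHNNExtension φ hφ)).FG := by
    rw [Subgroup.map_comap_eq]
    exact h _ _ ((Group.fg_iff_subgroup_fg _).1 inferInstance) hH
  rw [← Group.fg_iff_subgroup_fg] at h1 ⊢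
  exact Group.fg_of_surjective
    (f := ((H.comap of).equivMapOfInjective _ (of_injective (hφ := hφ))).symm.toMonoidHom)
    (MulEquiv.surjective _)

/-- The subgroup generated by the stable letter and a `φ`-invariant subgroup `N` of `F`, described
by normal forms. -/
def normalFormSubgroup (hφ : Function.Injective φ) {N : Subgroup F} (hN : N ≤ N.comap φ) :
    Subgroup (AscendingHNNExtension φ hφ) where
  carrier := {x | ∃ i j : ℕ, ∃ n ∈ N, t ^ i * x = of n * t ^ j}
  one_mem' := ⟨0, 0, 1, N.one_mem, by simp⟩
  mul_mem' := by
    rintro x y ⟨i, j, m, hm, hx⟩ ⟨k, l, n, hn, hy⟩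
    have iterate_mem (i : ℕ) {n : F} (hn : n ∈ N) : φ^[i] n ∈ N :=
      Set.MapsTo.iterate (f := φ) (s := (N : Set F)) hN i hn
    refine ⟨k + i, j + l, φ^[k] m * φ^[j] n, N.mul_mem (iterate_mem k hm) (iterate_mem j hn), ?_⟩
    calc t ^ (k + i) * (x * y) = t ^ k * (t ^ i * x) * y := by simp only [pow_add, mul_assoc]
      _ = of (φ^[k] m) * t ^ k * t ^ j * y := by rw [hx, ← mul_assoc, t_pow_mul_of]
      _ = of (φ^[k] m) * (t ^ j * (t ^ k * y)) := by
        rw [mul_assoc (of _), pow_mul_comm, mul_assoc, mul_assoc]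
      _ = of (φ^[k] m * φ^[j] n) * t ^ (j + l) := by
        rw [hy, ← mul_assoc (t ^ j), t_pow_mul_of, map_mul, pow_add]
        simp only [mul_assoc]
  inv_mem' := by
    rintro x ⟨i, j, n, hn, h⟩
    refine ⟨j, i, n⁻¹, N.inv_mem hn, ?_⟩
    rw [map_inv, eq_inv_mul_iff_mul_eq, ← mul_assoc, ← h, mul_inv_cancel_right]

theorem comap_normalFormSubgroup_le {N : Subgroup F} (hN : N.comap φ = N) :
    (normalFormSubgroup hφ hN.ge).comap of ≤ N := by
  rintro f ⟨i, j, n, hn, h⟩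
  rw [t_pow_mul_of] at h
  obtain rfl : i = j := by
    simpa [height_of, height_t, ← ofAdd_nsmul] using congrArg (height φ hφ) h
  have hf : φ^[i] f ∈ N := of_injective (mul_right_cancel h) ▸ hn
  clear h hn
  induction i with
  | zero => exact hf
  | succ i ih =>
    rw [Function.iterate_succ_apply'] at hf
    exact ih (hN.le hf)

theorem comap_closure_of_t (hφ : Function.Injective φ) {c : F}
    (hc : (orbitSubgroup φ c).comap φ = orbitSubgroup φ c) :
    (Subgroup.closure {of c, (t : AscendingHNNExtension φ hφ)}).comap of = orbitSubgroup φ c := by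
  apply le_antisymm
  · refine le_trans (Subgroup.comap_mono ?_) (comap_normalFormSubgroup_le hc)
    rw [Subgroup.closure_le]
    rintro _ (rfl | rfl)
    · exact ⟨0, 0, c, iterate_mem_orbitSubgroup φ c 0, by simp⟩
    · exact ⟨0, 1, 1, Subgroup.one_mem _, by simp⟩
  · refine (Subgroup.closure_le _).2 ?_
    rintro _ ⟨k, rfl⟩
    have of_iterate : (of (φ^[k] c) : AscendingHNNExtension φ hφ) = t ^ k * of c * (t ^ k)⁻¹ :=
      eq_mul_inv_of_mul_eq (t_pow_mul_of k c).symm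
    have ht : t ^ k ∈ Subgroup.closure {of c, (t : AscendingHNNExtension φ hφ)} :=
      pow_mem (Subgroup.subset_closure (by simp)) k
    refine Subgroup.mem_comap.2 (of_iterate ▸ mul_mem (mul_mem ht ?_) (inv_mem ht))
    exact Subgroup.subset_closure (by simp)

theorem not_hasFGIP_of_retraction [Group.FG F] (hφ : Function.Injective φ) {F₁ : Subgroup F}
    (hφF₁ : φ.range ≤ F₁) (r : F₁ →* F) (hr : ∀ f, r ⟨φ f, hφF₁ ⟨f, rfl⟩⟩ = f) {c : F₁}
    (hrc : r c = 1) (hc : c ≠ 1) : ¬ HasFGIP (AscendingHNNExtension φ hφ) := fun h =>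
  orbitSubgroup_not_fg hφF₁ r hr hrc hc <|
    comap_closure_of_t hφ (orbitSubgroup_comap_eq hφF₁ r hr hrc) ▸
      comap_of_fg h ((Subgroup.fg_iff _).2 ⟨_, rfl, Set.toFinite _⟩)

theorem not_hasFGIP_of_not_finiteIndex_range {ι : Type*} [Group.FG F] (b : FreeGroupBasis ι F)
    (hφ : Function.Injective φ) (hindex : ¬ φ.range.FiniteIndex) :
    ¬ HasFGIP (AscendingHNNExtension φ hφ) := by
  obtain ⟨F₁, hF₁, hle, r, hr⟩ :=
    exists_finiteIndex_retraction b ((Group.fg_iff_subgroup_fg φ.range).1 inferInstance)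
  obtain ⟨x, hxF₁, hx⟩ : ∃ x ∈ F₁, x ∉ φ.range := by
    by_contra! h
    exact hindex (le_antisymm h hle ▸ hF₁)
  let e := MonoidHom.ofInjective hφ
  let d : φ.range := r ⟨x, hxF₁⟩
  have hd : r (Subgroup.inclusion hle d) = d := hr d
  refine not_hasFGIP_of_retraction hφ hle (e.symm.toMonoidHom.comp r) (fun f => ?_)
    (c := ⟨x, hxF₁⟩ * (Subgroup.inclusion hle d)⁻¹) ?_ ?_
  · exact (congrArg e.symm (hr (e f))).trans (e.symm_apply_apply f)
  · simp [hd, d]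
  · rw [Ne, mul_inv_eq_one]
    intro h
    have hxd : x = d := congrArg Subtype.val h
    exact hx (hxd ▸ d.2)

theorem of_mul_t_pow_pow (c : F) (k m : ℕ) :
    (of c * t ^ k : AscendingHNNExtension φ hφ) ^ m =
      of ((fun f => c * φ^[k] f)^[m] 1) * t ^ (k * m) := by
  induction m with
  | zero => simp
  | succ m ih =>
    rw [pow_succ', ih, Function.iterate_succ_apply', map_mul, mul_assoc, ← mul_assoc (t ^ k),
      t_pow_mul_of, Nat.mul_succ, add_comm, pow_add]
    simp only [mul_assoc]

theorem normal_map_of (hs : Function.Surjective φ) (T : Subgroup F) [T.Characteristic] :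
    (T.map (of : F →* AscendingHNNExtension φ hφ)).Normal := by
  let e : F ≃* F := MulEquiv.ofBijective φ ⟨hφ, hs⟩
  have hT : T.map φ = T := Subgroup.characteristic_iff_map_eq.1 ‹_› e
  rw [← Subgroup.normalizer_eq_top_iff, Subgroup.eq_top_iff']
  intro g
  induction g using HNNExtension.induction_on with
  | of f =>
    have conj_of : (MulAut.conj (of f)).toMonoidHom.comp of =
        (of : F →* AscendingHNNExtension φ hφ).comp (MulAut.conj f).toMonoidHom := by
      ext; simp
    rw [Subgroup.mem_normalizer_iff_map_conj_eq, Subgroup.map_map]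
    exact (congrArg T.map conj_of).trans
      ((Subgroup.map_map ..).symm.trans (congrArg _ (Subgroup.Normal.map_conj_eq T f)))
  | t =>
    have conj_t : (MulAut.conj t).toMonoidHom.comp of =
        (of : F →* AscendingHNNExtension φ hφ).comp φ := by
      ext f; exact t_mul_of_mul_t_inv φ hφ f
    rw [Subgroup.mem_normalizer_iff_map_conj_eq, Subgroup.map_map]
    exact (congrArg T.map conj_t).trans
      ((Subgroup.map_map ..).symm.trans (congrArg _ hT))
  | mul g h hg hh => exact mul_mem hg hh
  | inv g hg => exact inv_mem hg

theorem comap_zpowers_sup_map_of_le (hs : Function.Surjective φ) {T : Subgroup F}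
    [T.Characteristic] {s : AscendingHNNExtension φ hφ} (hheight : height φ hφ s ≠ 1) :
    (Subgroup.zpowers s ⊔ T.map of).comap of ≤ T := by
  have := normal_map_of (hφ := hφ) hs T
  intro f hf
  obtain ⟨_, ⟨m, rfl⟩, _, ⟨n, hn, rfl⟩, h⟩ := Subgroup.mem_sup_of_normal_right.1 hf
  have hm : m = 0 := by
    have h1 : height φ hφ s ^ m = 1 := by simpa [height_of] using congrArg (height φ hφ) h
    exact (IsMulTorsionFree.zpow_eq_one_iff_right hheight).1 h1
  have h' : of n = (of f : AscendingHNNExtension φ hφ) := by simpa [hm] using h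
  exact of_injective h' ▸ hn

theorem comap_closure_of_t_le (hs : Function.Surjective φ) {T : Subgroup F} [T.Characteristic]
    {x : F} (hx : x ∈ T) :
    (Subgroup.closure {of x, (t : AscendingHNNExtension φ hφ)}).comap of ≤ T := by
  refine le_trans (Subgroup.comap_mono ?_)
    (comap_zpowers_sup_map_of_le (hφ := hφ) hs (s := t) (by rw [height_t]; decide))
  rw [Subgroup.closure_le]
  rintro _ (rfl | rfl)
  · exact Subgroup.mem_sup_right (Subgroup.mem_map_of_mem _ hx)
  · exact Subgroup.mem_sup_left (Subgroup.mem_zpowers _)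

theorem mem_comap_closure_of_t {x y : F} {n : ℕ} (h : φ^[n] y = x) :
    y ∈ (Subgroup.closure {of x, (t : AscendingHNNExtension φ hφ)}).comap of := by
  have of_y : (of y : AscendingHNNExtension φ hφ) = (t ^ n)⁻¹ * of x * t ^ n := by
    rw [mul_assoc, ← h, ← t_pow_mul_of, inv_mul_cancel_left]
  have ht : t ^ n ∈ Subgroup.closure {of x, (t : AscendingHNNExtension φ hφ)} :=
    pow_mem (Subgroup.subset_closure (by simp)) n
  exact Subgroup.mem_comap.2 <|
    of_y ▸ mul_mem (mul_mem (inv_mem ht) (Subgroup.subset_closure (by simp))) ht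

theorem conj_iterate_mem (hs : Function.Surjective φ) {N : Subgroup F} {x : F}
    (hN : ∀ n y, φ^[n] y = x → y ∈ N) (c : F) (k m : ℕ) :
    ((fun f => c * φ^[k] f)^[m] 1) * x * ((fun f => c * φ^[k] f)^[m] 1)⁻¹ ∈
      (Subgroup.zpowers (of c * t ^ k : AscendingHNNExtension φ hφ) ⊔ N.map of).comap of := by
  let s : AscendingHNNExtension φ hφ := of c * t ^ k
  obtain ⟨y, hy⟩ := hs.iterate (k * m) x
  have hsm : s ^ m ∈ Subgroup.zpowers s ⊔ N.map of :=
    Subgroup.mem_sup_left (Subgroup.npow_mem_zpowers s m)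
  have hyN : of y ∈ Subgroup.zpowers s ⊔ N.map of :=
    Subgroup.mem_sup_right (Subgroup.mem_map_of_mem _ (hN _ y hy))
  have h := mul_mem (mul_mem hsm hyN) (inv_mem hsm)
  rw [of_mul_t_pow_pow, mul_assoc (of _), t_pow_mul_of, hy] at h
  simpa [mul_assoc] using h

theorem abelianization_iterate_mul_one (φ : F →* F) (c : F) (k m : ℕ) :
    Abelianization.of ((fun f => c * φ^[k] f)^[m] 1) =
      (fun d => Abelianization.of c * (Abelianization.map φ)^[k] d)^[m] 1 := by
  have hk : Function.Semiconj Abelianization.of φ^[k] (Abelianization.map φ)^[k] :=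
    Function.Semiconj.iterate_right (fun f => (Abelianization.map_of φ f).symm) k
  have h : Function.Semiconj Abelianization.of (fun f => c * φ^[k] f)
      (fun d => Abelianization.of c * (Abelianization.map φ)^[k] d) := fun f => by
    rw [map_mul, hk.eq]
  exact (h.iterate_right m).eq 1

theorem not_hasFGIP_of_surjective {ι : Type*} [Nontrivial ι] [Group.FG F]
    (b : FreeGroupBasis ι F) (hφ : Function.Injective φ) (hs : Function.Surjective φ) :
    ¬ HasFGIP (AscendingHNNExtension φ hφ) := by
  intro h
  obtain ⟨i, j, hij⟩ := exists_pair_ne ι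
  let x : F := ⁅b i, b j⁆
  have hx : x ∈ commutator F :=
    Subgroup.commutator_mem_commutator (Subgroup.mem_top _) (Subgroup.mem_top _)
  let N : Subgroup F := (Subgroup.closure {of x, (t : AscendingHNNExtension φ hφ)}).comap of
  have hNfg : N.FG := comap_of_fg h ((Subgroup.fg_iff _).2 ⟨_, rfl, Set.toFinite _⟩)
  have hN : N ≤ commutator F := comap_closure_of_t_le hs hx
  have hα : Function.Injective (Abelianization.map φ) :=
    (MulEquiv.ofBijective φ ⟨hφ, hs⟩).abelianizationCongr.injective
  have : Group.FG (Abelianization F) := QuotientGroup.fg (commutator F)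
  obtain ⟨k, hk, d, hd⟩ :=
    exists_iterate_mul_one_injective (not_isOfFinOrder_abelianization_of b i) hα
  obtain ⟨c, rfl⟩ := QuotientGroup.mk_surjective d
  let s : AscendingHNNExtension φ hφ := of c * t ^ k
  have hheight : height φ hφ s ≠ 1 := by
    simp [s, height_of, height_t, ← ofAdd_nsmul, hk.ne']
  have hKfg : ((Subgroup.zpowers s ⊔ N.map of).comap of).FG := comap_of_fg h <|
    Subgroup.FG.sup ((Subgroup.fg_iff _).2 ⟨{s}, (Subgroup.zpowers_eq_closure s).symm, by simp⟩)
      (map_fg hNfg of)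
  have hK : (Subgroup.zpowers s ⊔ N.map of).comap of ≤ commutator F :=
    (Subgroup.comap_mono (sup_le_sup_left (Subgroup.map_mono hN) _)).trans
      (comap_zpowers_sup_map_of_le hs hheight)
  refine Set.infinite_range_of_injective hd
    ((finite_abelianization_conj_commutator_mem b hij hKfg hK).subset ?_)
  rintro _ ⟨m, rfl⟩
  exact ⟨_, abelianization_iterate_mul_one φ c k m,
    conj_iterate_mem hs (fun n y hy => mem_comap_closure_of_t hy) c k m⟩

end AscendingHNNExtension

theorem theorem1 {F ι : Type*} [Group F] [Group.FG F] (b : FreeGroupBasis ι F)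
    (hrank : 2 ≤ Cardinal.mk ι) (φ : F →* F) (hφ : Function.Injective φ) :
    ¬ HasFGIP (AscendingHNNExtension φ hφ) := by
  have : Finite ι := finite_of_freeGroupBasis b
  have hcard : 2 ≤ Nat.card ι := by
    rw [← Nat.cast_card] at hrank
    exact_mod_cast hrank
  by_cases hindex : φ.range.FiniteIndex
  · have : Nontrivial ι := Finite.one_lt_card_iff_nontrivial.1 hcard
    have hsurj : Function.Surjective φ := MonoidHom.range_eq_top.1 <|
      eq_top_of_finiteIndex b (b.map (MonoidHom.ofInjective hφ)) hcard
    exact AscendingHNNExtension.not_hasFGIP_of_surjective b hφ hsurj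
  · exact AscendingHNNExtension.not_hasFGIP_of_not_finiteIndex_range b hφ hindex
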